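/- Let $X$ be a (real or complex) Banach space and let $1\le p\le\infty$. We say that $X$ has $M_p$ if for every linear subspace $E\subseteq X$ every bounded operator $T\colon E\to\ell_p$ has an extension to a bounded operator $\widetilde T\colon X\to\ell_p$. For a subspace $E\subseteq X$ let $Q_E\colon X^*\to E^*$, $f\mapsto f|_E$, be the canonical quotient map. For $1\le p<\infty$, a bounded operator $S\colon V\to Z$ between normed spaces is called $p$-summing if there is a constant $C\ge 0$ such that $$\Big(\sum_{i=1}^n\|Sv_i\|^p\Big)^{1/p}\le C\,\sup\Big\{\Big(\sum_{i=1}^n|f(v_i)|^p\Big)^{1/p} : f\in V^*,\ \|f\|\le 1\Big\}$$ for all finite families $v_1,\dots,v_n\in V$, and $\pi_p(S)$ denotes the infimum of such constants $C$. For $p=\infty$ every bounded operator is regarded as $\infty$-summing, and $\pi_\infty(S)=\|S\|$. The following statements are equivalent. (i) $X$ has $M_p$. (ii) There exists a constant $K\ge 1$ such that for every linear subspace $E\subseteq X$, every Banach space $Z$ and every bounded operator $S\colon E^*\to Z$ for which $SQ_E\colon X^*\to Z$ is $p$-summing, the operator $S$ is $p$-summing and $$\pi_p(S)\le K\,\pi_p(SQ_E).$$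 -/

import Mathlib

open scoped ENNReal

universe u v w

noncomputable section

/-- The Banach space `X` has `M_p`: every bounded operator from a linear subspace `E` of `X` to
`ℓ_p` has a bounded extension to `X`. -/
def HasMp (𝕜 : Type v) [RCLike 𝕜] (X : Type u) [NormedAddCommGroup X] [NormedSpace 𝕜 X]
    (p : ℝ≥0∞) [Fact (1 ≤ p)] : Prop :=
  ∀ (E : Submodule 𝕜 X) (T : E →L[𝕜] lp (fun _ : ℕ => 𝕜) p),
    ∃ T' : X →L[𝕜] lp (fun _ : ℕ => 𝕜) p, ∀ x : E, T' (x : X) = T x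

/-- The weak `ℓ_q` norm of a finite family:
`sup {(∑ |f (x i)| ^ q) ^ (1 / q) : f ∈ X*, ‖f‖ ≤ 1}` (here `1 ≤ q < ∞`). -/
def weakLpNorm (𝕜 : Type v) [RCLike 𝕜] {X : Type u} [NormedAddCommGroup X] [NormedSpace 𝕜 X]
    (q : ℝ) {n : ℕ} (x : Fin n → X) : ℝ :=
  ⨆ f : Metric.closedBall (0 : StrongDual 𝕜 X) 1,
    (∑ i, ‖(f : StrongDual 𝕜 X) (x i)‖ ^ q) ^ (1 / q)

/-- The constants `C ≥ 0` with `(∑ ‖T (x i)‖ ^ q) ^ (1 / q) ≤ C * weakLpNorm q x` for all finite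
families `x` (here `1 ≤ q < ∞`). -/
def summingConstants {𝕜 : Type v} [RCLike 𝕜] {X : Type u} [NormedAddCommGroup X]
    [NormedSpace 𝕜 X] {Y : Type w} [NormedAddCommGroup Y] [NormedSpace 𝕜 Y]
    (q : ℝ) (T : X →L[𝕜] Y) : Set ℝ :=
  {C : ℝ | 0 ≤ C ∧ ∀ (n : ℕ) (x : Fin n → X),
    (∑ i, ‖T (x i)‖ ^ q) ^ (1 / q) ≤ C * weakLpNorm 𝕜 q x}

/-- `T` is `p`-summing. For `p = ∞` this is no restriction on the bounded operator `T`. -/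
def IsPSumming {𝕜 : Type v} [RCLike 𝕜] {X : Type u} [NormedAddCommGroup X]
    [NormedSpace 𝕜 X] {Y : Type w} [NormedAddCommGroup Y] [NormedSpace 𝕜 Y]
    (p : ℝ≥0∞) (T : X →L[𝕜] Y) : Prop :=
  p ≠ ∞ → (summingConstants p.toReal T).Nonempty

/-- The `p`-summing norm `π_p(T)` of a `p`-summing operator `T`; `π_∞` is the operator norm. -/
def summingNorm {𝕜 : Type v} [RCLike 𝕜] {X : Type u} [NormedAddCommGroup X]
    [NormedSpace 𝕜 X] {Y : Type w} [NormedAddCommGroup Y] [NormedSpace 𝕜 Y]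
    (p : ℝ≥0∞) (T : X →L[𝕜] Y) : ℝ :=
  open scoped Classical in if p = ∞ then ‖T‖ else sInf (summingConstants p.toReal T)

/-- The canonical quotient map `X* → E*`, `f ↦ f|E`. -/
def dualQuotientMap {𝕜 : Type v} [RCLike 𝕜] {X : Type u} [NormedAddCommGroup X]
    [NormedSpace 𝕜 X] (E : Submodule 𝕜 X) : StrongDual 𝕜 X →L[𝕜] StrongDual 𝕜 E :=
  ContinuousLinearMap.precomp 𝕜 E.subtypeL

end

/-!
For `p = ∞` both conditions hold for every `X`: operators into `ℓ_∞` extend coordinatewise by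
Hahn–Banach, and `X* → E*` is a metric surjection. Let `1 ≤ p < ∞`. An operator `E → ℓ_p` is a
sequence of functionals on `E` that is weakly `p`-summable, and an extension to `X` is a sequence of
lifts to `X*` that is weakly `p`-summable. The weak norm of a finite family in a dual space can be
computed on points of the space instead of the bidual (`weakLpNorm_le`,
`sum_rpow_apply_le_weakLpNorm`).

*From `M_p` to the inequality.* Extension is possible with one constant `K` for all subspaces at
once (`HasMp.exists_uniformExtension`). Lack of such a constant passes to every subspace of finite
codimension, since each drop of the codimension by one costs only a rank-one operator, which extends
by Hahn–Banach (`UniformExtension.of_inf_ker`); by compactness it is then witnessed on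
finite-dimensional subspaces. A gliding hump glues ever worse operators, placed on almost
independent finite-dimensional subspaces, into a single bounded operator without bounded extension
(`exists_unextendable`). Given `K`, a finite family in `E*` lifts to `X*` with weak norm at most `K`
times as large, and the summing inequality for `S Q_E` on the lifts is the one for `S`.

*From the inequality to `M_p`.* For finitely many points `y j` in the unit ball of `X` and weights
`μ j` of sum one, let `Z` be the quotient of a finite-dimensional `ℓ_p` by the image of
`ker Q_E` under `D f = (μ j ^ (1 / p) * f (y j))_j`, and let `S : E* → Z` be induced by `D`. Then
`S Q_E` is `p`-summing with constant `1`, so `S` is `p`-summing with constant `K`, which says that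
every finite family in `E*` has lifts whose average over `(y j, μ j)` is controlled
(`exists_lift_weighted_lt`). A minimax argument, based on the separation of convex sets in `ℝ^ι`,
makes the lifts independent of the weights (`exists_forall_lt_of_weighted_lt`), and compactness
gives the extension of the whole operator (`hasExtension_lp_of_finite`).
-/

/-! ### Extension of partially defined operators with uniform constants -/

section Extension

variable {𝕜 : Type v} [RCLike 𝕜] {X : Type u} [NormedAddCommGroup X] [NormedSpace 𝕜 X]
  {F : Type w} [NormedAddCommGroup F] [NormedSpace 𝕜 F]

/-- The partially defined operator `f` is bounded on its domain, with constant `C`. -/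
def BoundedOnDomain (f : X →ₗ.[𝕜] F) (C : ℝ) : Prop :=
  ∀ x : f.domain, ‖f x‖ ≤ C * ‖(x : X)‖

/-- The partially defined operator `f` extends to a bounded operator on `X` of norm at most `N`. -/
def HasExtension (f : X →ₗ.[𝕜] F) (N : ℝ) : Prop :=
  ∃ T : X →L[𝕜] F, (∀ x : f.domain, T x = f x) ∧ ‖T‖ ≤ N

/-- Every operator into `F` that is defined on a linear subspace of `Y` and is bounded by `1` there
extends to all of `X` with norm at most `K`. The norm of the extension is taken on `X`, not on `Y`,
so that no projection onto `Y` is involved. -/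
def UniformExtension (F : Type w) [NormedAddCommGroup F] [NormedSpace 𝕜 F]
    (Y : Submodule 𝕜 X) (K : ℝ) : Prop :=
  ∀ f : X →ₗ.[𝕜] F, f.domain ≤ Y → BoundedOnDomain f 1 → HasExtension f K

theorem HasExtension.mono {f : X →ₗ.[𝕜] F} {M N : ℝ} (h : HasExtension f M) (hMN : M ≤ N) :
    HasExtension f N :=
  let ⟨T, hT, hM⟩ := h
  ⟨T, hT, hM.trans hMN⟩

theorem UniformExtension.of_bound {Y : Submodule 𝕜 X} {K : ℝ}
    (h : UniformExtension F Y K) {f : X →ₗ.[𝕜] F} (hf : f.domain ≤ Y) {C : ℝ} (hC : 0 ≤ C)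
    (hb : BoundedOnDomain f C) : HasExtension f (K * C) := by
  rcases hC.eq_or_lt with rfl | hC
  · refine ⟨0, fun x => ?_, by simp⟩
    have := hb x
    rw [zero_mul] at this
    simpa using (norm_le_zero_iff.1 this).symm
  · have hCn : ‖((C : 𝕜))‖ = C := by rw [RCLike.norm_ofReal, abs_of_pos hC]
    have hC0 : (C : 𝕜) ≠ 0 := by exact_mod_cast hC.ne'
    obtain ⟨T, hT, hTK⟩ := h ((C : 𝕜)⁻¹ • f) hf (fun x => by
      rw [LinearPMap.smul_apply, norm_smul, norm_inv, hCn, one_mul, inv_mul_le_iff₀ hC]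
      exact hb x)
    refine ⟨(C : 𝕜) • T, fun x => ?_, ?_⟩
    · have := hT x
      rw [LinearPMap.smul_apply] at this
      rw [smul_apply, this, smul_inv_smul₀ hC0]
    · rw [norm_smul, hCn, mul_comm]
      exact mul_le_mul_of_nonneg_right hTK hC.le

/-- An operator on `E` that vanishes on `E ∩ ker a` has rank at most one, so it extends to `X` with
the same bound by Hahn–Banach. -/
theorem exists_extension_of_vanishing {E : Submodule 𝕜 X} (D : E →ₗ[𝕜] F) (a : StrongDual 𝕜 X)
    {C : ℝ} (hC : 0 ≤ C) (hD : ∀ x, ‖D x‖ ≤ C * ‖x‖) (h0 : ∀ x : E, a x = 0 → D x = 0) :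
    ∃ T : X →L[𝕜] F, (∀ x : E, T x = D x) ∧ ‖T‖ ≤ C := by
  by_cases hz : ∀ x, D x = 0
  · exact ⟨0, fun x => by simp [hz x], by simpa using hC⟩
  push Not at hz
  obtain ⟨e, he⟩ := hz
  have hae : a e ≠ 0 := fun h => he (h0 e h)
  have key : ∀ x : E, D x = (a x / a e) • D e := fun x => by
    have := h0 (x - (a x / a e) • e) (by simp [hae])
    rw [map_sub, map_smul, sub_eq_zero] at this
    exact this
  have hpos : 0 < ‖D e‖ := norm_pos_iff.2 he
  let φ : StrongDual 𝕜 E := (a e)⁻¹ • a.comp E.subtypeL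
  have hφ : ‖φ‖ ≤ C / ‖D e‖ := by
    refine ContinuousLinearMap.opNorm_le_bound _ (by positivity) fun x => ?_
    have h1 := hD x
    rw [key x, norm_smul] at h1
    have : φ x = a x / a e := by simp [φ, div_eq_inv_mul]
    rw [this, div_mul_eq_mul_div, le_div_iff₀ hpos]
    exact h1
  obtain ⟨g, hg, hgn⟩ := exists_extension_norm_eq E φ
  refine ⟨g.smulRight (D e), fun x => ?_, ?_⟩
  · rw [ContinuousLinearMap.smulRight_apply, hg, key x]
    simp [φ, div_eq_inv_mul]
  · rw [ContinuousLinearMap.norm_smulRight_apply, hgn]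
    exact (le_div_iff₀ hpos).1 hφ

/-- One can pass from `Y ∩ ker a` to `Y`: extend the restriction to `ker a`, and correct the extension
by an operator of rank at most one. -/
theorem UniformExtension.of_inf_ker {Y : Submodule 𝕜 X} {K : ℝ} (hK : 0 ≤ K)
    (a : StrongDual 𝕜 X) (h : UniformExtension F (a.ker ⊓ Y) K) :
    UniformExtension F Y (2 * K + 1) := by
  intro f hf hb
  obtain ⟨T, hT, hTK⟩ := h (f.domRestrict a.ker) (inf_le_inf_left _ hf) (fun x => by
    have := hb ⟨x, x.2.2⟩
    rwa [LinearPMap.domRestrict_apply (x := x) (y := ⟨x, x.2.2⟩) rfl])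
  let D : f.domain →ₗ[𝕜] F := f.toFun - T.toLinearMap.comp f.domain.subtype
  have hDx : ∀ x : f.domain, D x = f x - T x := fun x => rfl
  obtain ⟨R, hR, hRK⟩ := exists_extension_of_vanishing D a (C := 1 + K) (by positivity)
    (fun x => by
      rw [hDx, add_mul]
      exact (norm_sub_le _ _).trans (add_le_add (hb x) (T.le_of_opNorm_le hTK _)))
    (fun x hx => by
      have h1 := hT ⟨x, hx, x.2⟩
      have h2 : f.domRestrict a.ker ⟨x, hx, x.2⟩ = f x := LinearPMap.domRestrict_apply rfl
      rw [hDx, ← h2, ← h1, sub_self])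
  refine ⟨T + R, fun x => by simp [hR, hDx], (norm_add_le _ _).trans ?_⟩
  linarith

theorem exists_uniformExtension_of_finset (A : Finset (StrongDual 𝕜 X)) {K : ℝ}
    (h : UniformExtension F (A.inf fun a => a.ker) K) :
    ∃ K', UniformExtension F (⊤ : Submodule 𝕜 X) K' := by
  classical
  induction A using Finset.induction_on generalizing K with
  | empty => exact ⟨K, by simpa using h⟩
  | insert a A _ ih =>
    rw [Finset.inf_insert] at h
    refine ih (UniformExtension.of_inf_ker (le_max_right K 0) a fun f hf hb => ?_)
    exact (h f hf hb).mono (le_max_left _ _)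

/-- Mazur's lemma: for finite-dimensional `G` there is a subspace of finite codimension, the common
kernel of functionals that almost norm `G`, along which the projection to `G` has norm at most
`1 + ε`. -/
theorem exists_finset_norm_le_add (G : Submodule 𝕜 X) [FiniteDimensional 𝕜 G] {ε : ℝ}
    (hε : 0 < ε) :
    ∃ A : Finset (StrongDual 𝕜 X), ∀ x ∈ G, ∀ y ∈ A.inf (fun a => a.ker),
      ‖x‖ ≤ (1 + ε) * ‖x + y‖ := by
  classical
  have : ProperSpace G := FiniteDimensional.proper 𝕜 G
  choose a ha hax using fun x : X => exists_dual_vector'' 𝕜 x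
  obtain ⟨t, ht⟩ := (isCompact_sphere (0 : G) 1).elim_finite_subcover
    (fun x : G => {z : G | 1 < (1 + ε) * ‖a x z‖})
    (fun x => isOpen_lt continuous_const (by fun_prop))
    (fun x hx => by
      have hx1 : ‖(x : X)‖ = 1 := by simpa using hx
      refine Set.mem_iUnion.2 ⟨x, ?_⟩
      simp only [Set.mem_ofPred_eq, hax, hx1]
      simp [hε])
  refine ⟨t.image fun x : G => a x, fun x hx y hy => ?_⟩
  rcases eq_or_ne x 0 with rfl | hx0
  · rw [norm_zero]; positivity
  have hn : 0 < ‖x‖ := norm_pos_iff.2 hx0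
  have hmem : ((‖x‖ : 𝕜)⁻¹ • ⟨x, hx⟩ : G) ∈ Metric.sphere (0 : G) 1 := by
    simp [norm_smul, hn.ne']
  obtain ⟨z, hz, hlt⟩ := Set.mem_iUnion₂.1 (ht hmem)
  have hlt' : 1 < (1 + ε) * (‖x‖⁻¹ * ‖a z x‖) := by
    simpa [norm_smul] using hlt
  have hy0 : a z y = 0 := by
    have := (Submodule.mem_finsetInf.1 hy) (a z) (Finset.mem_image_of_mem (fun x : G => a x) hz)
    simpa using this
  have hb : ‖a z x‖ ≤ ‖x + y‖ := by
    have : a z x = a z (x + y) := by rw [map_add, hy0, add_zero]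
    rw [this]
    simpa using (a z).le_of_opNorm_le (ha z) (x + y)
  have h2 : ‖x‖ < (1 + ε) * ‖a z x‖ := by
    have := mul_lt_mul_of_pos_left hlt' hn
    rw [mul_one] at this
    refine this.trans_eq ?_
    field_simp
  exact h2.le.trans (by gcongr)

/-- A step of the gliding hump: a bounded operator `f` with finite-dimensional domain is prolonged,
with an arbitrarily small increase of its bound, to an operator without extension of norm `N`. The
prolongation is a small multiple of an operator that is hard to extend, placed on a subspace almost
independent of the domain of `f`. -/
theorem exists_le_not_hasExtension
    (hbad : ∀ (A : Finset (StrongDual 𝕜 X)) (K : ℝ), ∃ f : X →ₗ.[𝕜] F,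
      f.domain ≤ A.inf (fun a => a.ker) ∧ FiniteDimensional 𝕜 f.domain ∧
        BoundedOnDomain f 1 ∧ ¬ HasExtension f K)
    (f : X →ₗ.[𝕜] F) [FiniteDimensional 𝕜 f.domain] {C C' : ℝ} (hC : 0 ≤ C) (hCC' : C < C')
    (hf : BoundedOnDomain f C) (N : ℝ) :
    ∃ g : X →ₗ.[𝕜] F, f ≤ g ∧ FiniteDimensional 𝕜 g.domain ∧ BoundedOnDomain g C' ∧
      ¬ HasExtension g N := by
  set δ := C' - C with hδ
  have hδ0 : 0 < δ := by rw [hδ]; linarith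
  -- With these choices `C * (1 + ε) + 3 * c ≤ C + δ`.
  set ε := min 1 (δ / (2 * (C + 1))) with hε
  have hε0 : 0 < ε := by rw [hε]; positivity
  have hε1 : ε ≤ 1 := min_le_left _ _
  have hCε : C * ε ≤ δ / 2 := by
    have h1 : ε ≤ δ / (2 * (C + 1)) := min_le_right _ _
    rw [le_div_iff₀ (by positivity)] at h1
    nlinarith
  set c := δ / 6 with hc
  have hc0 : 0 < c := by positivity
  have hcn : ‖(c : 𝕜)‖ = c := by rw [RCLike.norm_ofReal, abs_of_pos hc0]
  have hc0' : (c : 𝕜) ≠ 0 := by exact_mod_cast hc0.ne'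
  obtain ⟨A, hA⟩ := exists_finset_norm_le_add f.domain hε0
  obtain ⟨h, hY, hfin, hb, hne⟩ := hbad A (N / c)
  have hdis : Disjoint f.domain ((c : 𝕜) • h).domain := by
    rw [Submodule.disjoint_def]
    intro x hx hx'
    have := hA x hx (-x) (Submodule.neg_mem _ (hY hx'))
    simpa using this
  let g := f.sup ((c : 𝕜) • h) (LinearPMap.sup_h_of_disjoint _ _ hdis)
  refine ⟨g, LinearPMap.left_le_sup _ _ _, ?_, ?_, ?_⟩
  · have : g.domain = f.domain ⊔ h.domain := rfl
    rw [this]; infer_instance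
  · intro z
    obtain ⟨x, hx, y, hy, hz⟩ := Submodule.mem_sup.1 z.2
    have hgz : g z = f ⟨x, hx⟩ + (c : 𝕜) • h ⟨y, hy⟩ :=
      LinearPMap.sup_apply (LinearPMap.sup_h_of_disjoint _ _ hdis) ⟨x, hx⟩ ⟨y, hy⟩ z hz
    have h1 := hA x hx y (hY hy)
    rw [hz] at h1
    have h2 : ‖y‖ ≤ 3 * ‖(z : X)‖ := by
      have : y = z - x := by rw [← hz]; abel
      have h3 : ‖y‖ ≤ ‖(z : X)‖ + ‖x‖ := by rw [this]; exact norm_sub_le _ _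
      nlinarith [norm_nonneg (z : X)]
    have h4 : ‖f ⟨x, hx⟩‖ ≤ C * ‖x‖ := hf ⟨x, hx⟩
    have h5 : ‖h ⟨y, hy⟩‖ ≤ 1 * ‖y‖ := hb ⟨y, hy⟩
    have h6 : ‖g z‖ ≤ C * ‖x‖ + c * ‖y‖ := by
      rw [hgz]
      refine (norm_add_le _ _).trans (add_le_add h4 ?_)
      rw [norm_smul, hcn]
      gcongr; linarith
    have h7 : C * ‖x‖ ≤ C * ((1 + ε) * ‖(z : X)‖) := by gcongr
    have h8 : c * ‖y‖ ≤ c * (3 * ‖(z : X)‖) := by gcongr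
    have h9 : C * ε * ‖(z : X)‖ ≤ δ / 2 * ‖(z : X)‖ := by gcongr
    calc ‖g z‖ ≤ C * ((1 + ε) * ‖(z : X)‖) + c * (3 * ‖(z : X)‖) := by linarith
      _ = C * ‖(z : X)‖ + C * ε * ‖(z : X)‖ + δ / 2 * ‖(z : X)‖ := by rw [hc]; ring
      _ ≤ C * ‖(z : X)‖ + δ / 2 * ‖(z : X)‖ + δ / 2 * ‖(z : X)‖ := by linarith
      _ = C' * ‖(z : X)‖ := by rw [hδ]; ring
  · rintro ⟨T, hT, hTN⟩
    refine hne ⟨(c : 𝕜)⁻¹ • T, fun y => ?_, ?_⟩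
    · have hle : (c : 𝕜) • h ≤ g := LinearPMap.right_le_sup _ _ _
      have h1 : ((c : 𝕜) • h) y = g ⟨y, hle.1 y.2⟩ := hle.2 rfl
      have h2 := hT ⟨y, hle.1 y.2⟩
      rw [← h1, LinearPMap.smul_apply] at h2
      rw [smul_apply, h2, inv_smul_smul₀ hc0']
    · rw [norm_smul, norm_inv, hcn, div_eq_inv_mul]
      gcongr

/-- The gliding hump: if on every subspace of finite codimension there are operators that are
arbitrarily hard to extend, then there is one bounded operator without any bounded extension. -/
theorem exists_unextendable
    (hbad : ∀ (A : Finset (StrongDual 𝕜 X)) (K : ℝ), ∃ f : X →ₗ.[𝕜] F,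
      f.domain ≤ A.inf (fun a => a.ker) ∧ FiniteDimensional 𝕜 f.domain ∧
        BoundedOnDomain f 1 ∧ ¬ HasExtension f K) :
    ∃ f : X →ₗ.[𝕜] F, BoundedOnDomain f 2 ∧ ∀ N, ¬ HasExtension f N := by
  -- The bounds stay strictly below `2`, which leaves room for the next step.
  let P : (X →ₗ.[𝕜] F) → Prop := fun f =>
    FiniteDimensional 𝕜 f.domain ∧ ∃ C, 0 ≤ C ∧ C < 2 ∧ BoundedOnDomain f C
  have step : ∀ (n : ℕ) (f : {f // P f}), ∃ g : {g // P g}, f.1 ≤ g.1 ∧ ¬ HasExtension g.1 n := by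
    rintro n ⟨f, hfin, C, hC0, hC2, hC⟩
    obtain ⟨g, hfg, hg, hgb, hgn⟩ := exists_le_not_hasExtension hbad f hC0
      (C' := (C + 2) / 2) (by linarith) hC n
    exact ⟨⟨g, hg, _, by linarith, by linarith, hgb⟩, hfg, hgn⟩
  choose next hnext hnot using step
  have h0 : P ⊥ := ⟨inferInstanceAs (FiniteDimensional 𝕜 (⊥ : Submodule 𝕜 X)), 0, le_rfl,
    two_pos, fun x => by
      have : x = 0 := Subtype.ext ((Submodule.mem_bot 𝕜).1 x.2)
      rw [this, LinearPMap.map_zero]; simp⟩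
  let s : ℕ → {f // P f} := fun n => Nat.rec ⟨⊥, h0⟩ (fun n f => next n f) n
  have hs : ∀ n, s (n + 1) = next n (s n) := fun n => rfl
  have hmono : Monotone fun n => (s n).1 :=
    monotone_nat_of_le_succ fun n => by rw [hs]; exact hnext n (s n)
  have hdir : DirectedOn (· ≤ ·) (Set.range fun n => (s n).1) :=
    directedOn_range.2 hmono.directed_le
  have hle : ∀ n, (s n).1 ≤ LinearPMap.sSup _ hdir := fun n => LinearPMap.le_sSup hdir ⟨n, rfl⟩
  refine ⟨LinearPMap.sSup _ hdir, fun x => ?_, fun N => ?_⟩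
  · have hx := (LinearPMap.domain_sSup hdir).le x.2
    rw [Submodule.mem_sSup_of_directed] at hx
    · obtain ⟨_, ⟨_, ⟨n, rfl⟩, rfl⟩, hxn⟩ := hx
      obtain ⟨-, C, -, hC2, hC⟩ := (s n).2
      have h1 : (s n).1 ⟨x, hxn⟩ = LinearPMap.sSup _ hdir x := (hle n).2 rfl
      have h2 := hC ⟨x, hxn⟩
      rw [h1] at h2
      exact h2.trans (by gcongr)
    · exact (Set.range_nonempty _).image _
    · rw [directedOn_image]
      exact fun f hf g hg => let ⟨k, hk, h1, h2⟩ := hdir f hf g hg; ⟨k, hk, h1.1, h2.1⟩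
  · rintro ⟨T, hT, hTN⟩
    obtain ⟨n, hn⟩ := exists_nat_ge N
    refine hnot n (s n) ⟨T, fun x => ?_, hTN.trans hn⟩
    have h1 := (hle (n + 1)).2 (x := x) (y := ⟨x, (hle (n + 1)).1 x.2⟩) rfl
    rw [hT ⟨x, (hle (n + 1)).1 x.2⟩]
    exact h1.symm

end Extension

/-! ### Compactness for operators into `ℓ_p` -/

section Compactness

open Filter Topology

variable {𝕜 : Type v} [RCLike 𝕜] {X : Type u} [NormedAddCommGroup X] [NormedSpace 𝕜 X]

/-- Pointwise bounded linear functionals converge pointwise along an ultrafilter. -/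
theorem exists_linearMap_tendsto_ultrafilter {α : Type*} (U : Ultrafilter α)
    (R : α → X →ₗ[𝕜] 𝕜) (B : X → ℝ) (hB : ∀ x, ∀ᶠ t in U, ‖R t x‖ ≤ B x) :
    ∃ L : X →ₗ[𝕜] 𝕜, ∀ x, Tendsto (fun t => R t x) U (𝓝 (L x)) := by
  have key : ∀ x, ∃ y, Tendsto (fun t => R t x) U (𝓝 y) := fun x => by
    have hle : (U.map fun t => R t x : Filter 𝕜) ≤ 𝓟 (Metric.closedBall 0 (B x)) := by
      rw [Ultrafilter.coe_map, le_principal_iff, mem_map]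
      refine mem_of_superset (hB x) fun t ht => ?_
      simpa using ht
    obtain ⟨y, -, hy⟩ := (isCompact_closedBall (0 : 𝕜) (B x)).ultrafilter_le_nhds _ hle
    exact ⟨y, hy⟩
  choose L hL using key
  exact ⟨linearMapOfTendsto L R (tendsto_pi_nhds.2 hL), hL⟩

/-- To extend an operator into `ℓ_p` with norm at most `K`, it suffices to find, for each finite set
`A` of points and each `n`, linear functionals that agree with the first `n` coordinates at the points
of `A` in the domain and satisfy the norm estimate at the points of `A`. -/
theorem hasExtension_lp_of_finite {p : ℝ≥0∞} [Fact (1 ≤ p)] (hp : p ≠ ∞)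
    (f : X →ₗ.[𝕜] lp (fun _ : ℕ => 𝕜) p) {K : ℝ} (hK : 0 ≤ K)
    (h : ∀ (A : Finset X) (n : ℕ), ∃ R : ℕ → X →ₗ[𝕜] 𝕜,
      (∀ x : f.domain, (x : X) ∈ A → ∀ i < n, R i x = f x i) ∧
        ∀ x ∈ A, ∑ i ∈ Finset.range n, ‖R i x‖ ^ p.toReal ≤ (K * ‖x‖) ^ p.toReal) :
    HasExtension f K := by
  classical
  have hp0 : 0 < p.toReal := ENNReal.toReal_pos (zero_lt_one.trans_le Fact.out).ne' hp
  choose R hR hRK using h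
  let U : Ultrafilter (Finset X × ℕ) := Ultrafilter.of atTop
  have hU : (U : Filter (Finset X × ℕ)) ≤ atTop := Ultrafilter.of_le _
  have hev : ∀ (x : X) (n : ℕ), ∀ᶠ t : Finset X × ℕ in U, x ∈ t.1 ∧ n ≤ t.2 := fun x n =>
    hU ((eventually_ge_atTop (({x} : Finset X), n)).mono fun t ht =>
      ⟨ht.1 (Finset.mem_singleton_self x), ht.2⟩)
  have hex : ∀ i, ∃ L : X →ₗ[𝕜] 𝕜,
      ∀ x, Tendsto (fun t : Finset X × ℕ => R t.1 t.2 i x) U (𝓝 (L x)) :=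
    fun i => exists_linearMap_tendsto_ultrafilter U _ (fun x => K * ‖x‖) fun x => by
      filter_upwards [hev x (i + 1)] with t ht
      have h1 : ‖R t.1 t.2 i x‖ ^ p.toReal ≤ (K * ‖x‖) ^ p.toReal :=
        (Finset.single_le_sum (f := fun i => ‖R t.1 t.2 i x‖ ^ p.toReal)
          (fun _ _ => by positivity) (Finset.mem_range.2 ht.2)).trans (hRK t.1 t.2 x ht.1)
      exact (Real.rpow_le_rpow_iff (norm_nonneg _) (by positivity) hp0).1 h1
  choose L hL using hex
  have hLf : ∀ (x : f.domain) i, L i x = f x i := fun x i => by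
    refine tendsto_nhds_unique (hL i x) (tendsto_const_nhds.congr' ?_)
    filter_upwards [hev x (i + 1)] with t ht
    exact (hR t.1 t.2 x ht.1 i ht.2).symm
  have hsum : ∀ (x : X) (s : Finset ℕ), ∑ i ∈ s, ‖L i x‖ ^ p.toReal ≤ (K * ‖x‖) ^ p.toReal := by
    intro x s
    refine le_of_tendsto (tendsto_finsetSum s fun i _ =>
      ((hL i x).norm.rpow_const (Or.inr hp0.le))) ?_
    obtain ⟨n, hn⟩ := s.exists_nat_subset_range
    filter_upwards [hev x n] with t ht
    exact (Finset.sum_le_sum_of_subset_of_nonneg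
      (hn.trans (Finset.range_mono ht.2)) fun _ _ _ => by positivity).trans (hRK t.1 t.2 x ht.1)
  let T : X →ₗ[𝕜] lp (fun _ : ℕ => 𝕜) p :=
    { toFun := fun x => ⟨fun i => L i x, memℓp_gen' (hsum x)⟩
      map_add' := fun x y => by ext i; exact map_add (L i) x y
      map_smul' := fun c x => by ext i; exact map_smul (L i) c x }
  refine ⟨T.mkContinuous K fun x =>
    lp.norm_le_of_forall_sum_le hp0 (by positivity) (hsum x), fun x => ?_,
    LinearMap.mkContinuous_norm_le _ hK _⟩
  ext i
  exact hLf x i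

/-- The best constant for extension is determined by finite-dimensional subspaces. -/
theorem uniformExtension_lp_of_finiteDimensional {p : ℝ≥0∞} [Fact (1 ≤ p)] (hp : p ≠ ∞)
    {Y : Submodule 𝕜 X} {K : ℝ} (hK : 0 ≤ K)
    (h : ∀ f : X →ₗ.[𝕜] lp (fun _ : ℕ => 𝕜) p, f.domain ≤ Y → FiniteDimensional 𝕜 f.domain →
      BoundedOnDomain f 1 → HasExtension f K) :
    UniformExtension (lp (fun _ : ℕ => 𝕜) p) Y K := by
  intro f hf hb
  have hp0 : 0 < p.toReal := ENNReal.toReal_pos (zero_lt_one.trans_le Fact.out).ne' hp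
  refine hasExtension_lp_of_finite hp f hK fun A n => ?_
  let G : Submodule 𝕜 X := Submodule.span 𝕜 (A ∩ f.domain : Set X)
  have hG : G ≤ f.domain := Submodule.span_le.2 Set.inter_subset_right
  have hfin : FiniteDimensional 𝕜 G :=
    FiniteDimensional.span_of_finite 𝕜 (A.finite_toSet.inter_of_left _)
  obtain ⟨T, hT, hTK⟩ := h ⟨G, f.toFun.comp (Submodule.inclusion hG)⟩ (hG.trans hf) hfin
    (fun x => hb (Submodule.inclusion hG x))
  refine ⟨fun i => ⟨⟨fun x => T x i, fun x y => by simp⟩, fun c x => by simp⟩, ?_, ?_⟩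
  · intro x hx i _
    exact congrArg (fun v : lp (fun _ : ℕ => 𝕜) p => v i)
      (hT ⟨x, Submodule.subset_span ⟨hx, x.2⟩⟩)
  · intro x _
    refine (lp.sum_rpow_le_norm_rpow hp0 (T x) _).trans ?_
    gcongr
    exact T.le_of_opNorm_le hTK x

/-- `M_p` implies extension with one constant for all subspaces. -/
theorem HasMp.exists_uniformExtension {p : ℝ≥0∞} [Fact (1 ≤ p)] (hp : p ≠ ∞)
    (h : HasMp 𝕜 X p) :
    ∃ K, UniformExtension (lp (fun _ : ℕ => 𝕜) p) (⊤ : Submodule 𝕜 X) K := by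
  by_contra! hno
  obtain ⟨f, hf, hfN⟩ := exists_unextendable (𝕜 := 𝕜) (X := X) (F := lp (fun _ : ℕ => 𝕜) p)
    fun A K => by
      by_contra! hA
      obtain ⟨K', hK'⟩ := exists_uniformExtension_of_finset A
        (uniformExtension_lp_of_finiteDimensional hp (le_max_right K 0) fun f h1 h2 h3 =>
          (hA f h1 h2 h3).mono (le_max_left _ _))
      exact hno K' hK'
  obtain ⟨T, hT⟩ := h f.domain (f.toFun.mkContinuous 2 hf)
  exact hfN ‖T‖ ⟨T, hT, le_rfl⟩

end Compactness

/-! ### The weak `ℓ_q` norm of a family of functionals -/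

section WeakNorm

variable {𝕜 : Type v} [RCLike 𝕜] {V : Type u} [NormedAddCommGroup V] [NormedSpace 𝕜 V]

/-- A weak `ℓ_q` estimate of a family of functionals that holds at the points of `V` also holds at
the points of the bidual: a norming functional `b` of the vector `(φ (g i))` in `ℓ_q^n` turns the
left-hand side into `φ ψ`, where `ψ` is a combination of the `g i` with `‖ψ‖ ≤ C`. -/
theorem sum_rpow_bidual_le {q : ℝ} (hq : 1 ≤ q) {n : ℕ} (g : Fin n → StrongDual 𝕜 V) {C : ℝ}
    (hC : 0 ≤ C) (hg : ∀ x, (∑ i, ‖g i x‖ ^ q) ^ (1 / q) ≤ C * ‖x‖)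
    {φ : StrongDual 𝕜 (StrongDual 𝕜 V)} (hφ : ‖φ‖ ≤ 1) :
    (∑ i, ‖φ (g i)‖ ^ q) ^ (1 / q) ≤ C := by
  have hq0 : 0 < q := by linarith
  let r : ℝ≥0∞ := ENNReal.ofReal q
  have hr : r.toReal = q := ENNReal.toReal_ofReal hq0.le
  have : Fact (1 ≤ r) := ⟨by simpa [r] using hq⟩
  have hnorm : ∀ v : PiLp r (fun _ : Fin n => 𝕜), ‖v‖ = (∑ i, ‖v i‖ ^ q) ^ (1 / q) := fun v => by
    rw [PiLp.norm_eq_sum (by rwa [hr]), hr]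
  let v : PiLp r (fun _ : Fin n => 𝕜) := WithLp.toLp r fun i => φ (g i)
  obtain ⟨b, hb, hbv⟩ := exists_dual_vector'' 𝕜 v
  have hbsum : ∀ w : PiLp r (fun _ : Fin n => 𝕜), b w = ∑ i, w i * b (PiLp.single r i 1) := by
    intro w
    have hw : w = ∑ i, w i • PiLp.single r i (1 : 𝕜) := by
      ext j; simp [Pi.single_apply]
    conv_lhs => rw [hw]
    simp only [map_sum, map_smul, smul_eq_mul]
  let ψ : StrongDual 𝕜 V := ∑ i, b (PiLp.single r i 1) • g i
  have hψ : ‖ψ‖ ≤ C := ContinuousLinearMap.opNorm_le_bound _ hC fun x => by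
    have h1 : ψ x = b (WithLp.toLp r fun i => g i x) := by
      rw [hbsum]; simp [ψ, mul_comm]
    rw [h1]
    refine (b.le_of_opNorm_le hb _).trans ?_
    rw [one_mul, hnorm]
    exact hg x
  have h2 : φ ψ = (‖v‖ : 𝕜) := by
    rw [← hbv, hbsum]; simp [ψ, v, mul_comm]
  calc (∑ i, ‖φ (g i)‖ ^ q) ^ (1 / q) = ‖v‖ := (hnorm v).symm
    _ = ‖φ ψ‖ := by rw [h2]; simp
    _ ≤ 1 * ‖ψ‖ := φ.le_of_opNorm_le hφ ψ
    _ ≤ C := by rwa [one_mul]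

theorem weakLpNorm_le {q : ℝ} (hq : 1 ≤ q) {n : ℕ} (g : Fin n → StrongDual 𝕜 V) {C : ℝ}
    (hC : 0 ≤ C) (hg : ∀ x, (∑ i, ‖g i x‖ ^ q) ^ (1 / q) ≤ C * ‖x‖) :
    weakLpNorm 𝕜 q g ≤ C := by
  have : Nonempty (Metric.closedBall (0 : StrongDual 𝕜 (StrongDual 𝕜 V)) 1) :=
    ⟨⟨0, by simp⟩⟩
  exact ciSup_le fun φ => sum_rpow_bidual_le hq g hC hg (mem_closedBall_zero_iff.1 φ.2)

theorem weakLpNorm_nonneg {q : ℝ} {n : ℕ} (x : Fin n → V) : 0 ≤ weakLpNorm 𝕜 q x :=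
  Real.iSup_nonneg fun _ => by positivity

theorem le_weakLpNorm {q : ℝ} (hq : 0 < q) {n : ℕ} (x : Fin n → V) {φ : StrongDual 𝕜 V}
    (hφ : ‖φ‖ ≤ 1) : (∑ i, ‖φ (x i)‖ ^ q) ^ (1 / q) ≤ weakLpNorm 𝕜 q x := by
  refine le_ciSup (f := fun f : Metric.closedBall (0 : StrongDual 𝕜 V) 1 =>
    (∑ i, ‖(f : StrongDual 𝕜 V) (x i)‖ ^ q) ^ (1 / q))
    ⟨(∑ i, ‖x i‖ ^ q) ^ (1 / q), ?_⟩ ⟨φ, by simpa using hφ⟩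
  rintro _ ⟨f, rfl⟩
  have hf : ‖(f : StrongDual 𝕜 V)‖ ≤ 1 := mem_closedBall_zero_iff.1 f.2
  dsimp only
  gcongr with i
  simpa using (f : StrongDual 𝕜 V).le_of_opNorm_le hf (x i)

theorem sum_rpow_apply_le_weakLpNorm {q : ℝ} (hq : 0 < q) {n : ℕ} (g : Fin n → StrongDual 𝕜 V)
    (x : V) : (∑ i, ‖g i x‖ ^ q) ^ (1 / q) ≤ weakLpNorm 𝕜 q g * ‖x‖ := by
  rcases eq_or_ne x 0 with rfl | hx
  · simp [Real.zero_rpow hq.ne', hq.ne']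
  have hn : 0 < ‖x‖ := norm_pos_iff.2 hx
  have h := le_weakLpNorm hq g
    (φ := NormedSpace.inclusionInDoubleDual 𝕜 V ((‖x‖ : 𝕜)⁻¹ • x))
    ((NormedSpace.double_dual_bound 𝕜 V _).trans (by simp [norm_smul, hn.ne']))
  have h1 : ∀ i, ‖NormedSpace.inclusionInDoubleDual 𝕜 V ((‖x‖ : 𝕜)⁻¹ • x) (g i)‖ ^ q
      = (‖x‖⁻¹) ^ q * ‖g i x‖ ^ q := fun i => by
    rw [NormedSpace.dual_def, map_smul, norm_smul, Real.mul_rpow (norm_nonneg _) (norm_nonneg _)]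
    simp
  simp only [h1] at h
  rw [← Finset.mul_sum, Real.mul_rpow (by positivity) (by positivity), ← Real.rpow_mul (by positivity),
    mul_one_div_cancel hq.ne', Real.rpow_one, inv_mul_le_iff₀ hn, mul_comm] at h
  exact h

end WeakNorm

/-! ### A minimax lemma -/

section Minimax

/-- A minimax lemma for finitely many functions `φ j` that are jointly convexlike on `C` (no linear
structure on `V` is required): if every weighted average of them takes a value below `κ`, then they
are below `κ` simultaneously at some point. -/
theorem exists_forall_lt_of_weighted_lt {ι V : Type*} [Fintype ι] {C : Set V} (hne : C.Nonempty)
    {φ : ι → V → ℝ}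
    (hφ : ∀ v ∈ C, ∀ v' ∈ C, ∀ a b : ℝ, 0 ≤ a → 0 ≤ b → a + b = 1 →
      ∃ w ∈ C, ∀ j, φ j w ≤ a * φ j v + b * φ j v') {κ : ℝ}
    (h : ∀ μ : ι → ℝ, (∀ j, 0 ≤ μ j) → ∑ j, μ j = 1 → ∃ v ∈ C, ∑ j, μ j * φ j v < κ) :
    ∃ v ∈ C, ∀ j, φ j v < κ := by
  classical
  by_contra hno
  -- If not, the constant vector `κ` is separated from this open convex set by a functional `l`,
  -- which is nonnegative as the set is closed upwards; normalized, `l` is a forbidden weight.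
  let t : Set (ι → ℝ) := {z | ∃ v ∈ C, ∀ j, φ j v < z j}
  have htc : Convex ℝ t := by
    rintro z ⟨v, hv, hvz⟩ z' ⟨v', hv', hvz'⟩ a b ha hb hab
    obtain ⟨w, hw, hwj⟩ := hφ v hv v' hv' a b ha hb hab
    refine ⟨w, hw, fun j => (hwj j).trans_lt ?_⟩
    simp only [smul_eq_mul, Pi.add_apply, Pi.smul_apply]
    rcases ha.eq_or_lt with rfl | ha
    · have hb1 : b = 1 := by linarith
      simpa [hb1] using hvz' j
    · exact add_lt_add_of_lt_of_le (mul_lt_mul_of_pos_left (hvz j) ha)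
        (mul_le_mul_of_nonneg_left (hvz' j).le hb)
  have hto : IsOpen t := by
    have : t = ⋃ v ∈ C, Set.univ.pi fun j => Set.Ioi (φ j v) := by
      ext z; simp [t]
    rw [this]
    exact isOpen_biUnion fun v _ => isOpen_set_pi Set.finite_univ fun j _ => isOpen_Ioi
  obtain ⟨f, hf⟩ := geometric_hahn_banach_point_open htc hto (x := fun _ => κ) hno
  let l : ι → ℝ := fun j => f (Pi.single j 1)
  have hfl : ∀ z, f z = ∑ j, l j * z j := fun z => by
    conv_lhs => rw [← Finset.univ_sum_single z]
    rw [map_sum]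
    refine Finset.sum_congr rfl fun j _ => ?_
    have : (Pi.single j (z j) : ι → ℝ) = z j • Pi.single j 1 := by
      rw [← Pi.single_smul]; simp
    rw [this, map_smul, smul_eq_mul, mul_comm]
  obtain ⟨v₀, hv₀⟩ := hne
  have hl : ∀ j, 0 ≤ l j := fun j => by
    by_contra! hj
    let z : ι → ℝ := fun j => φ j v₀ + 1
    have hz : f (fun _ => κ) < f z := hf z ⟨v₀, hv₀, fun j => by simp [z]⟩
    have hs : 0 ≤ (f z - f fun _ => κ) / (-l j) := div_nonneg (by linarith) (by linarith)
    have := hf (z + ((f z - f fun _ => κ) / (-l j)) • Pi.single j 1) ⟨v₀, hv₀, fun i => by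
      have : (0 : ℝ) ≤ (Pi.single j 1 : ι → ℝ) i := by
        rw [Pi.single_apply]; split_ifs <;> norm_num
      have := mul_nonneg hs this
      simp only [z, Pi.add_apply, Pi.smul_apply, smul_eq_mul]
      linarith⟩
    rw [map_add, map_smul, smul_eq_mul] at this
    have h2 : (f z - f fun _ => κ) / (-l j) * f (Pi.single j 1) = -(f z - f fun _ => κ) := by
      change _ / (-l j) * l j = _
      field_simp [hj.ne]
    rw [h2] at this
    linarith
  have hκ : f (fun _ => κ) = (∑ j, l j) * κ := by rw [hfl, Finset.sum_mul]
  have hsum : 0 < ∑ j, l j := by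
    refine (Finset.sum_nonneg fun j _ => hl j).lt_of_ne fun h0 => ?_
    have hl0 : ∀ j, l j = 0 := fun j =>
      (Finset.sum_eq_zero_iff_of_nonneg fun j _ => hl j).1 h0.symm j (Finset.mem_univ j)
    have := hf (fun j => φ j v₀ + 1) ⟨v₀, hv₀, fun j => by simp⟩
    simp [hfl, hl0] at this
  obtain ⟨v, hv, hlt⟩ := h (fun j => l j / ∑ j, l j) (fun j => div_nonneg (hl j) hsum.le)
    (by rw [← Finset.sum_div, div_self hsum.ne'])
  have hlt' : ∑ j, l j * φ j v < (∑ j, l j) * κ := by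
    have : ∑ j, (l j / ∑ j, l j) * φ j v = (∑ j, l j * φ j v) / ∑ j, l j := by
      rw [Finset.sum_div]
      exact Finset.sum_congr rfl fun j _ => by ring
    rwa [this, div_lt_iff₀ hsum, mul_comm κ] at hlt
  set s := ((∑ j, l j) * κ - ∑ j, l j * φ j v) / ∑ j, l j with hs
  have hs0 : 0 < s := div_pos (by linarith) hsum
  have := hf (fun j => φ j v + s) ⟨v, hv, fun j => by simp [hs0]⟩
  rw [hκ, hfl] at this
  simp only [mul_add, Finset.sum_add_distrib, ← Finset.sum_mul] at this
  rw [hs, mul_div_cancel₀ _ hsum.ne'] at this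
  linarith

end Minimax

/-! ### Lifting families of functionals -/

section Lifting

variable {𝕜 : Type v} [RCLike 𝕜] {X : Type u} [NormedAddCommGroup X] [NormedSpace 𝕜 X]

theorem dualQuotientMap_apply (E : Submodule 𝕜 X) (f : StrongDual 𝕜 X) (x : E) :
    dualQuotientMap E f x = f x := rfl

theorem exists_dualQuotientMap_eq (E : Submodule 𝕜 X) (g : StrongDual 𝕜 E) :
    ∃ f, dualQuotientMap E f = g ∧ ‖f‖ = ‖g‖ :=
  let ⟨f, hf, hn⟩ := exists_extension_norm_eq E g
  ⟨f, ContinuousLinearMap.ext hf, hn⟩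

/-- The infimum that defines `π_p` is attained. -/
theorem IsPSumming.sum_rpow_le {V : Type*} [NormedAddCommGroup V] [NormedSpace 𝕜 V]
    {Z : Type*} [NormedAddCommGroup Z] [NormedSpace 𝕜 Z] {p : ℝ≥0∞} (hp : p ≠ ∞)
    {S : V →L[𝕜] Z} (hS : IsPSumming p S) {n : ℕ} (x : Fin n → V) :
    (∑ i, ‖S (x i)‖ ^ p.toReal) ^ (1 / p.toReal) ≤
      summingNorm p S * weakLpNorm 𝕜 p.toReal x := by
  obtain ⟨C, hC⟩ := hS hp
  rw [summingNorm, if_neg hp]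
  rcases (weakLpNorm_nonneg (𝕜 := 𝕜) (q := p.toReal) x).eq_or_lt with h0 | h0
  · have := hC.2 n x
    rw [← h0, mul_zero] at this ⊢
    exact this
  · rw [← div_le_iff₀ h0]
    exact le_csInf ⟨C, hC⟩ fun C' hC' => (div_le_iff₀ h0).2 (hC'.2 n x)

theorem summingNorm_le {V : Type*} [NormedAddCommGroup V] [NormedSpace 𝕜 V]
    {Z : Type*} [NormedAddCommGroup Z] [NormedSpace 𝕜 Z] {p : ℝ≥0∞} (hp : p ≠ ∞)
    {S : V →L[𝕜] Z} {C : ℝ} (hC : C ∈ summingConstants p.toReal S) : summingNorm p S ≤ C := by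
  rw [summingNorm, if_neg hp]
  exact csInf_le ⟨0, fun C hC => hC.1⟩ hC

/-- Lifts that are good on average. The inequality between the summing norms is applied to the map
`S` from `E*` to a quotient of a finite-dimensional weighted `ℓ_p` space for which `S Q_E f` is the
class of `(μ j ^ (1 / p) * f (y j))_j`. -/
theorem exists_lift_weighted_lt {p : ℝ≥0∞} [Fact (1 ≤ p)] (hp : p ≠ ∞) (E : Submodule 𝕜 X)
    {K : ℝ} (hK : 0 ≤ K)
    (hE : ∀ (Z : Type (max u v)) [NormedAddCommGroup Z] [NormedSpace 𝕜 Z] [CompleteSpace Z]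
      (S : StrongDual 𝕜 E →L[𝕜] Z), IsPSumming p (S.comp (dualQuotientMap E)) →
        IsPSumming p S ∧ summingNorm p S ≤ K * summingNorm p (S.comp (dualQuotientMap E)))
    {n : ℕ} (g : Fin n → StrongDual 𝕜 E) {κ : ℝ}
    (hκ : (K * weakLpNorm 𝕜 p.toReal g) ^ p.toReal < κ)
    {ι : Type (max u v)} [Fintype ι] (y : ι → X) (hy : ∀ j, ‖y j‖ ≤ 1)
    (μ : ι → ℝ) (hμ : ∀ j, 0 ≤ μ j) (hμ1 : ∑ j, μ j = 1) :
    ∃ f : Fin n → StrongDual 𝕜 X, (∀ i, dualQuotientMap E (f i) = g i) ∧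
      ∑ j, μ j * ∑ i, ‖f i (y j)‖ ^ p.toReal < κ := by
  have hq0 : 0 < p.toReal := ENNReal.toReal_pos (zero_lt_one.trans_le Fact.out).ne' hp
  set q := p.toReal with hq
  -- The weights are chosen so that `‖D f‖ ^ q` is the average of `‖f (y j)‖ ^ q`.
  let D : StrongDual 𝕜 X →ₗ[𝕜] PiLp p (fun _ : ι => 𝕜) :=
    { toFun := fun f => WithLp.toLp p fun j => ((μ j ^ (1 / q) : ℝ) : 𝕜) * f (y j)
      map_add' := fun f f' => by ext j; simp [mul_add]
      map_smul' := fun c f => by ext j; simp [mul_left_comm] }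
  have hD : ∀ f, ‖D f‖ ^ q = ∑ j, μ j * ‖f (y j)‖ ^ q := fun f => by
    rw [PiLp.norm_eq_sum hq0, ← hq, ← Real.rpow_mul (by positivity), one_div_mul_cancel hq0.ne',
      Real.rpow_one]
    refine Finset.sum_congr rfl fun j _ => ?_
    have : ‖(D f) j‖ = μ j ^ (1 / q) * ‖f (y j)‖ := by
      change ‖((μ j ^ (1 / q) : ℝ) : 𝕜) * f (y j)‖ = _
      rw [norm_mul, RCLike.norm_ofReal, abs_of_nonneg (Real.rpow_nonneg (hμ j) _)]
    rw [this, Real.mul_rpow (Real.rpow_nonneg (hμ j) _) (norm_nonneg _),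
      ← Real.rpow_mul (hμ j), one_div_mul_cancel hq0.ne', Real.rpow_one]
  have hDle : ∀ f, ‖D f‖ ≤ ‖f‖ := fun f => by
    refine (Real.rpow_le_rpow_iff (norm_nonneg _) (norm_nonneg _) hq0).1 ?_
    rw [hD]
    calc ∑ j, μ j * ‖f (y j)‖ ^ q ≤ ∑ j, μ j * ‖f‖ ^ q := by
          gcongr with j
          · exact hμ j
          · exact f.unit_le_opNorm _ (hy j)
      _ = ‖f‖ ^ q := by rw [← Finset.sum_mul, hμ1, one_mul]
  let Q : StrongDual 𝕜 X →ₗ[𝕜] StrongDual 𝕜 E := (dualQuotientMap E).toLinearMap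
  -- A linear section `σ` of `Q`, in general unbounded, makes `S₀` a linear map by construction.
  obtain ⟨σ, hσ⟩ := Q.exists_rightInverse_of_surjective (LinearMap.range_eq_top.2 fun g =>
    let ⟨f, hf, _⟩ := exists_dualQuotientMap_eq E g; ⟨f, hf⟩)
  have hσ' : ∀ g, dualQuotientMap E (σ g) = g := fun g => LinearMap.congr_fun hσ g
  let W : Submodule 𝕜 (PiLp p fun _ : ι => 𝕜) := Q.ker.map D
  have hW : IsClosed (W : Set (PiLp p fun _ : ι => 𝕜)) := W.closed_of_finiteDimensional
  have hcomp : CompleteSpace (PiLp p (fun _ : ι => 𝕜) ⧸ W) := FiniteDimensional.complete 𝕜 _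
  let S₀ : StrongDual 𝕜 E →ₗ[𝕜] PiLp p (fun _ : ι => 𝕜) ⧸ W := W.mkQ ∘ₗ D ∘ₗ σ
  have hS₀ : ∀ f, S₀ (dualQuotientMap E f) = W.mkQ (D f) := fun f => by
    refine (Submodule.Quotient.eq W).2 ⟨σ (dualQuotientMap E f) - f, ?_, map_sub _ _ _⟩
    change dualQuotientMap E (σ (dualQuotientMap E f) - f) = 0
    rw [map_sub, hσ', sub_self]
  have hS₀le : ∀ f, ‖S₀ (dualQuotientMap E f)‖ ≤ ‖D f‖ := fun f => by
    rw [hS₀]; exact Submodule.Quotient.norm_mk_le W _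
  let S : StrongDual 𝕜 E →L[𝕜] PiLp p (fun _ : ι => 𝕜) ⧸ W := S₀.mkContinuous 1 fun g => by
    obtain ⟨f, rfl, hf⟩ := exists_dualQuotientMap_eq E g
    rw [one_mul, ← hf]
    exact (hS₀le f).trans (hDle f)
  have hSQ : (1 : ℝ) ∈ summingConstants q (S.comp (dualQuotientMap E)) := by
    refine ⟨zero_le_one, fun m f => ?_⟩
    set w := weakLpNorm 𝕜 q f with hw
    have hw0 : 0 ≤ w := weakLpNorm_nonneg _
    rw [one_mul, one_div, Real.rpow_inv_le_iff_of_pos (by positivity) hw0 hq0]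
    calc ∑ i, ‖S (dualQuotientMap E (f i))‖ ^ q ≤ ∑ i, ‖D (f i)‖ ^ q := by
          gcongr with i; exact hS₀le (f i)
      _ = ∑ j, μ j * ∑ i, ‖f i (y j)‖ ^ q := by
          simp only [hD, Finset.mul_sum]; exact Finset.sum_comm
      _ ≤ ∑ j, μ j * w ^ q := by
          gcongr with j
          · exact hμ j
          · rw [← Real.rpow_inv_le_iff_of_pos (by positivity) hw0 hq0, ← one_div]
            exact (sum_rpow_apply_le_weakLpNorm hq0 f (y j)).trans
              (mul_le_of_le_one_right hw0 (hy j))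
      _ = w ^ q := by rw [← Finset.sum_mul, hμ1, one_mul]
  obtain ⟨hS, hSK⟩ := hE _ S fun _ => ⟨1, hSQ⟩
  have hSg : ∑ i, ‖S (g i)‖ ^ q < κ := by
    refine lt_of_le_of_lt ?_ hκ
    have hw0 : 0 ≤ weakLpNorm 𝕜 q g := weakLpNorm_nonneg _
    rw [← Real.rpow_inv_le_iff_of_pos (by positivity) (by positivity) hq0, ← one_div]
    refine (hS.sum_rpow_le hp g).trans ?_
    gcongr
    exact hSK.trans (mul_le_of_le_one_right hK (summingNorm_le hp hSQ))
  obtain ⟨ε, hεκ, hε⟩ : ∃ ε : ℝ, ∑ i, (‖S (g i)‖ + ε) ^ q < κ ∧ 0 < ε := by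
    have hcont : Continuous fun ε : ℝ => ∑ i, (‖S (g i)‖ + ε) ^ q :=
      continuous_finsetSum _ fun i _ =>
        (continuous_const.add continuous_id).rpow_const fun _ => Or.inr hq0.le
    have h1 : ∀ᶠ ε in nhds (0 : ℝ), ∑ i, (‖S (g i)‖ + ε) ^ q < κ :=
      hcont.continuousAt.eventually_lt continuousAt_const (by simpa using hSg)
    exact ((h1.filter_mono nhdsWithin_le_nhds).and
      (self_mem_nhdsWithin : Set.Ioi (0 : ℝ) ∈ nhdsWithin 0 (Set.Ioi 0))).exists
  have hlift : ∀ i, ∃ f, dualQuotientMap E f = g i ∧ ‖D f‖ ≤ ‖S (g i)‖ + ε := fun i => by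
    obtain ⟨m, hm, hmn⟩ := Submodule.Quotient.norm_mk_lt (S (g i)) hε
    obtain ⟨h, hh, hhm⟩ := (Submodule.Quotient.eq W).1 (hm : W.mkQ m = W.mkQ (D (σ (g i))))
    refine ⟨σ (g i) + h, ?_, ?_⟩
    · rw [map_add, hσ', show dualQuotientMap E h = 0 from hh, add_zero]
    · rw [map_add, show D h = m - D (σ (g i)) from hhm, add_sub_cancel]
      exact hmn.le
  choose f hf hfn using hlift
  refine ⟨f, hf, lt_of_le_of_lt ?_ hεκ⟩
  calc ∑ j, μ j * ∑ i, ‖f i (y j)‖ ^ q = ∑ i, ‖D (f i)‖ ^ q := by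
        simp only [hD, Finset.mul_sum]; exact Finset.sum_comm
    _ ≤ _ := by gcongr with i; exact hfn i

/-- By the minimax lemma, lifts that are good on every average can be chosen good at every point. -/
theorem exists_lift_forall_lt {p : ℝ≥0∞} [Fact (1 ≤ p)] (hp : p ≠ ∞) (E : Submodule 𝕜 X)
    {K : ℝ} (hK : 0 ≤ K)
    (hE : ∀ (Z : Type (max u v)) [NormedAddCommGroup Z] [NormedSpace 𝕜 Z] [CompleteSpace Z]
      (S : StrongDual 𝕜 E →L[𝕜] Z), IsPSumming p (S.comp (dualQuotientMap E)) →
        IsPSumming p S ∧ summingNorm p S ≤ K * summingNorm p (S.comp (dualQuotientMap E)))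
    {n : ℕ} (g : Fin n → StrongDual 𝕜 E) {κ : ℝ}
    (hκ : (K * weakLpNorm 𝕜 p.toReal g) ^ p.toReal < κ)
    {ι : Type (max u v)} [Fintype ι] (y : ι → X) (hy : ∀ j, ‖y j‖ ≤ 1) :
    ∃ f : Fin n → StrongDual 𝕜 X, (∀ i, dualQuotientMap E (f i) = g i) ∧
      ∀ j, ∑ i, ‖f i (y j)‖ ^ p.toReal < κ := by
  have hq1 : 1 ≤ p.toReal := (ENNReal.dichotomy p).resolve_left hp
  refine exists_forall_lt_of_weighted_lt
    (C := {f : Fin n → StrongDual 𝕜 X | ∀ i, dualQuotientMap E (f i) = g i})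
    (φ := fun j f => ∑ i, ‖f i (y j)‖ ^ p.toReal) ?_ ?_
    fun μ hμ hμ1 => exists_lift_weighted_lt hp E hK hE g hκ y hy μ hμ hμ1
  · choose f hf using exists_dualQuotientMap_eq E
    exact ⟨fun i => f (g i), fun i => (hf (g i)).1⟩
  · intro f hf f' hf' a b ha hb hab
    refine ⟨fun i => (a : 𝕜) • f i + (b : 𝕜) • f' i, fun i => ?_, fun j => ?_⟩
    · rw [map_add, map_smul, map_smul, hf i, hf' i]
      refine (add_smul (a : 𝕜) (b : 𝕜) (g i)).symm.trans ?_
      rw [← RCLike.ofReal_add, hab, RCLike.ofReal_one]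
      exact one_smul 𝕜 (g i)
    · rw [Finset.mul_sum, Finset.mul_sum, ← Finset.sum_add_distrib]
      refine Finset.sum_le_sum fun i _ => ?_
      refine le_trans (Real.rpow_le_rpow (norm_nonneg _) ?_ (by linarith))
        ((convexOn_rpow hq1).2 (norm_nonneg (f i (y j))) (norm_nonneg (f' i (y j))) ha hb hab)
      refine (norm_add_le ((a : 𝕜) • f i (y j)) ((b : 𝕜) • f' i (y j))).trans_eq ?_
      rw [norm_smul, norm_smul, RCLike.norm_ofReal, RCLike.norm_ofReal, abs_of_nonneg ha,
        abs_of_nonneg hb, smul_eq_mul, smul_eq_mul]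

theorem exists_lift_forall_le {p : ℝ≥0∞} [Fact (1 ≤ p)] (hp : p ≠ ∞) (E : Submodule 𝕜 X)
    {K : ℝ} (hK : 0 ≤ K)
    (hE : ∀ (Z : Type (max u v)) [NormedAddCommGroup Z] [NormedSpace 𝕜 Z] [CompleteSpace Z]
      (S : StrongDual 𝕜 E →L[𝕜] Z), IsPSumming p (S.comp (dualQuotientMap E)) →
        IsPSumming p S ∧ summingNorm p S ≤ K * summingNorm p (S.comp (dualQuotientMap E)))
    {n : ℕ} (g : Fin n → StrongDual 𝕜 E) {M : ℝ} (hM : K * weakLpNorm 𝕜 p.toReal g < M)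
    (A : Finset X) :
    ∃ f : Fin n → StrongDual 𝕜 X, (∀ i, dualQuotientMap E (f i) = g i) ∧
      ∀ x ∈ A, ∑ i, ‖f i x‖ ^ p.toReal ≤ (M * ‖x‖) ^ p.toReal := by
  have hq0 : 0 < p.toReal := ENNReal.toReal_pos (zero_lt_one.trans_le Fact.out).ne' hp
  have hKw : 0 ≤ K * weakLpNorm 𝕜 p.toReal g := mul_nonneg hK (weakLpNorm_nonneg _)
  have hM0 : 0 ≤ M := hKw.trans hM.le
  obtain ⟨f, hf, hfy⟩ := exists_lift_forall_lt hp E hK hE g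
    (Real.rpow_lt_rpow hKw hM hq0)
    -- `ULift` only adjusts the universe; the point `0` of `A` is kept by `0⁻¹ • 0 = 0`.
    (fun j : ULift.{v} A => ((‖(j.down : X)‖ : 𝕜)⁻¹) • (j.down : X)) fun j => by
      simp only [norm_smul, norm_inv, RCLike.norm_ofReal, abs_norm]
      exact inv_mul_le_one
  refine ⟨f, hf, fun x hx => ?_⟩
  rcases eq_or_ne x 0 with rfl | hx0
  · simp [Real.zero_rpow hq0.ne']
  have hn : 0 < ‖x‖ := norm_pos_iff.2 hx0
  have h1 := (hfy ⟨⟨x, hx⟩⟩).le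
  have h2 : ∀ i, ‖f i ((‖x‖ : 𝕜)⁻¹ • x)‖ ^ p.toReal
      = (‖x‖ ^ p.toReal)⁻¹ * ‖f i x‖ ^ p.toReal := fun i => by
    rw [map_smul, norm_smul, norm_inv, RCLike.norm_ofReal, abs_norm,
      Real.mul_rpow (by positivity) (by positivity), Real.inv_rpow (by positivity)]
  simp only [h2] at h1
  rwa [← Finset.mul_sum, inv_mul_le_iff₀ (by positivity), ← Real.mul_rpow (by positivity) hM0,
    mul_comm ‖x‖] at h1

end Lifting

/-! ### The two implications -/

section Main

variable {𝕜 : Type v} [RCLike 𝕜] {X : Type u} [NormedAddCommGroup X] [NormedSpace 𝕜 X]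

theorem hasMp_top [Fact ((1 : ℝ≥0∞) ≤ ∞)] : HasMp 𝕜 X ∞ := by
  intro E T
  let c : ℕ → StrongDual 𝕜 E := fun i =>
    LinearMap.mkContinuous ⟨⟨fun x => T x i, fun x y => by simp⟩, fun a x => by simp⟩ ‖T‖
      fun x => (lp.norm_apply_le_norm ENNReal.top_ne_zero _ i).trans (T.le_opNorm x)
  have hc : ∀ i, ‖c i‖ ≤ ‖T‖ := fun i => LinearMap.mkContinuous_norm_le _ (norm_nonneg _) _
  choose d hd hdn using fun i => exists_extension_norm_eq E (c i)
  have hdb : ∀ x i, ‖d i x‖ ≤ ‖T‖ * ‖x‖ := fun x i =>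
    (d i).le_of_opNorm_le ((hdn i).trans_le (hc i)) x
  let R : X →ₗ[𝕜] lp (fun _ : ℕ => 𝕜) ∞ :=
    { toFun := fun x => ⟨fun i => d i x,
        memℓp_infty ⟨‖T‖ * ‖x‖, by rintro _ ⟨i, rfl⟩; exact hdb x i⟩⟩
      map_add' := fun x y => by ext i; exact map_add (d i) x y
      map_smul' := fun a x => by ext i; exact map_smul (d i) a x }
  refine ⟨R.mkContinuous ‖T‖ fun x => lp.norm_le_of_forall_le (by positivity) (hdb x), ?_⟩
  intro x
  ext i
  exact hd i x

theorem norm_le_norm_comp_dualQuotientMap (E : Submodule 𝕜 X) {Z : Type*} [NormedAddCommGroup Z]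
    [NormedSpace 𝕜 Z] (S : StrongDual 𝕜 E →L[𝕜] Z) : ‖S‖ ≤ ‖S.comp (dualQuotientMap E)‖ := by
  have h0 : 0 ≤ ‖S.comp (dualQuotientMap E)‖ := ContinuousLinearMap.opNorm_nonneg _
  refine S.opNorm_le_bound h0 fun g => ?_
  obtain ⟨f, rfl, hf⟩ := exists_dualQuotientMap_eq E g
  rw [← hf]
  exact (S.comp (dualQuotientMap E)).le_opNorm f

theorem HasMp.of_summing {p : ℝ≥0∞} [Fact (1 ≤ p)] (hp : p ≠ ∞) {K : ℝ} (hK : 0 ≤ K)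
    (h : ∀ (E : Submodule 𝕜 X) (Z : Type (max u v)) [NormedAddCommGroup Z] [NormedSpace 𝕜 Z]
      [CompleteSpace Z] (S : StrongDual 𝕜 E →L[𝕜] Z), IsPSumming p (S.comp (dualQuotientMap E)) →
        IsPSumming p S ∧ summingNorm p S ≤ K * summingNorm p (S.comp (dualQuotientMap E))) :
    HasMp 𝕜 X p := by
  intro E T
  have hq1 : 1 ≤ p.toReal := (ENNReal.dichotomy p).resolve_left hp
  have hq0 : 0 < p.toReal := by linarith
  let c : ℕ → StrongDual 𝕜 E := fun i =>
    LinearMap.mkContinuous ⟨⟨fun x => T x i, fun x y => by simp⟩, fun a x => by simp⟩ ‖T‖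
      fun x => (lp.norm_apply_le_norm (zero_lt_one.trans_le Fact.out).ne' _ i).trans
        (T.le_opNorm x)
  have hw : ∀ n, weakLpNorm 𝕜 p.toReal (fun i : Fin n => c i) ≤ ‖T‖ := fun n =>
    weakLpNorm_le hq1 _ (norm_nonneg _) fun x => by
      rw [one_div, Real.rpow_inv_le_iff_of_pos (by positivity) (by positivity) hq0,
        Fin.sum_univ_eq_sum_range (fun i => ‖c i x‖ ^ p.toReal)]
      refine (lp.sum_rpow_le_norm_rpow hq0 (T x) _).trans ?_
      gcongr
      exact T.le_opNorm x
  obtain ⟨T', hT', -⟩ := hasExtension_lp_of_finite hp ⟨E, T.toLinearMap⟩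
    -- The norm of the extension is immaterial; adding `1` makes room for a strict inequality.
    (K := K * ‖T‖ + 1) (by positivity) fun A n => by
      obtain ⟨f, hf, hfA⟩ := exists_lift_forall_le hp E hK (h E) (fun i : Fin n => c i)
        (M := K * ‖T‖ + 1) (by nlinarith [hw n]) A
      refine ⟨fun i => if hi : i < n then (f ⟨i, hi⟩).toLinearMap else 0, ?_, ?_⟩
      · intro x _ i hi
        simp only [hi, dif_pos]
        exact congrArg (fun φ : StrongDual 𝕜 E => φ x) (hf ⟨i, hi⟩)
      · intro x hx
        refine le_trans (le_of_eq ?_) (hfA x hx)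
        rw [Finset.sum_range]
        simp
  exact ⟨T', hT'⟩

/-- If operators into `ℓ_p` extend with constant `K`, then a finite family in `E*` lifts to `X*` with
weak norm at most `K` times as large, which transfers summing constants from `S Q_E` to `S`. -/
theorem UniformExtension.mul_mem_summingConstants {p : ℝ≥0∞} [Fact (1 ≤ p)] (hp : p ≠ ∞) {K : ℝ}
    (hK : 0 ≤ K) (h : UniformExtension (lp (fun _ : ℕ => 𝕜) p) (⊤ : Submodule 𝕜 X) K)
    (E : Submodule 𝕜 X) {Z : Type*} [NormedAddCommGroup Z] [NormedSpace 𝕜 Z]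
    (S : StrongDual 𝕜 E →L[𝕜] Z) {C : ℝ}
    (hC : C ∈ summingConstants p.toReal (S.comp (dualQuotientMap E))) :
    K * C ∈ summingConstants p.toReal S := by
  classical
  have hq1 : 1 ≤ p.toReal := (ENNReal.dichotomy p).resolve_left hp
  have hq0 : 0 < p.toReal := by linarith
  refine ⟨mul_nonneg hK hC.1, fun n g => ?_⟩
  have hw0 : 0 ≤ weakLpNorm 𝕜 p.toReal g := weakLpNorm_nonneg _
  let G : ℕ → StrongDual 𝕜 E := fun k => if hk : k < n then g ⟨k, hk⟩ else 0
  have hG : ∀ i : Fin n, G i = g i := fun i => by simp [G]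
  let T : E →ₗ[𝕜] lp (fun _ : ℕ => 𝕜) p :=
    { toFun := fun x => ∑ k ∈ Finset.range n, lp.single p k (G k x)
      map_add' := fun x y => by simp [Finset.sum_add_distrib]
      map_smul' := fun a x => by
        simp only [map_smul, lp.single_smul, Finset.smul_sum, RingHom.id_apply] }
  have hT : BoundedOnDomain (⟨E, T⟩ : X →ₗ.[𝕜] lp (fun _ : ℕ => 𝕜) p)
      (weakLpNorm 𝕜 p.toReal g) := fun x => by
    refine le_trans (le_of_eq ?_) (sum_rpow_apply_le_weakLpNorm hq0 g x)
    have h1 : ‖T x‖ ^ p.toReal = ∑ i, ‖g i x‖ ^ p.toReal := by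
      refine (lp.norm_sum_single hq0 (fun k => G k x) (Finset.range n)).trans ?_
      rw [Finset.sum_range]
      simp only [hG]
    rw [← h1, ← Real.rpow_mul (norm_nonneg _), mul_one_div_cancel hq0.ne', Real.rpow_one]
    rfl
  obtain ⟨T', hT', hTn⟩ := h.of_bound le_top hw0 hT
  let f : Fin n → StrongDual 𝕜 X := fun i =>
    LinearMap.mkContinuous ⟨⟨fun x => T' x i, fun x y => by simp⟩, fun a x => by simp⟩ ‖T'‖
      fun x => (lp.norm_apply_le_norm (zero_lt_one.trans_le Fact.out).ne' _ _).trans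
        (T'.le_opNorm x)
  have hf : ∀ i, dualQuotientMap E (f i) = g i := fun i => by
    ext x
    have h1 : f i x = T x i := congrArg (fun v : lp (fun _ : ℕ => 𝕜) p => v i) (hT' x)
    rw [dualQuotientMap_apply, h1, ← hG]
    change (∑ k ∈ Finset.range n, lp.single (E := fun _ : ℕ => 𝕜) p k (G k x)) (i : ℕ) = G i x
    simp only [lp.coeFn_sum, Finset.sum_apply, lp.coeFn_single, Finset.sum_pi_single]
    simp
  have hfw : weakLpNorm 𝕜 p.toReal f ≤ K * weakLpNorm 𝕜 p.toReal g :=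
    weakLpNorm_le hq1 _ (by positivity) fun x => by
      rw [one_div, Real.rpow_inv_le_iff_of_pos (by positivity) (by positivity) hq0]
      refine le_trans ?_ (Real.rpow_le_rpow (norm_nonneg _) (T'.le_of_opNorm_le hTn x) hq0.le)
      refine le_trans (le_of_eq ?_) (lp.sum_rpow_le_norm_rpow hq0 (T' x) (Finset.range n))
      rw [Finset.sum_range]
      rfl
  calc (∑ i, ‖S (g i)‖ ^ p.toReal) ^ (1 / p.toReal)
      = (∑ i, ‖S.comp (dualQuotientMap E) (f i)‖ ^ p.toReal) ^ (1 / p.toReal) := by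
        simp only [ContinuousLinearMap.comp_apply, hf]
    _ ≤ C * weakLpNorm 𝕜 p.toReal f := hC.2 n f
    _ ≤ C * (K * weakLpNorm 𝕜 p.toReal g) := mul_le_mul_of_nonneg_left hfw hC.1
    _ = K * C * weakLpNorm 𝕜 p.toReal g := by ring

end Main

theorem theorem3p6 {𝕜 : Type v} [RCLike 𝕜] (X : Type u) [NormedAddCommGroup X]
    [NormedSpace 𝕜 X] [CompleteSpace X] (p : ℝ≥0∞) [Fact (1 ≤ p)] :
    HasMp 𝕜 X p ↔
      ∃ K : ℝ, 1 ≤ K ∧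
        ∀ (E : Submodule 𝕜 X) (Z : Type (max u v)) [NormedAddCommGroup Z] [NormedSpace 𝕜 Z]
          [CompleteSpace Z] (S : StrongDual 𝕜 E →L[𝕜] Z),
          IsPSumming p (S.comp (dualQuotientMap E)) →
            IsPSumming p S ∧
              summingNorm p S ≤ K * summingNorm p (S.comp (dualQuotientMap E)) := by
  by_cases hp : p = ∞
  · subst hp
    refine ⟨fun _ => ⟨1, le_rfl, fun E Z _ _ _ S _ => ⟨fun h => absurd rfl h, ?_⟩⟩,
      fun _ => hasMp_top⟩
    rw [summingNorm, summingNorm, if_pos rfl, if_pos rfl, one_mul]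
    exact norm_le_norm_comp_dualQuotientMap E S
  · refine ⟨fun h => ?_, fun ⟨K, hK, h⟩ => HasMp.of_summing hp (zero_le_one.trans hK) h⟩
    obtain ⟨K, hK⟩ := h.exists_uniformExtension hp
    have hK1 : (0 : ℝ) < max K 1 := lt_max_of_lt_right one_pos
    have hU : UniformExtension (lp (fun _ : ℕ => 𝕜) p) (⊤ : Submodule 𝕜 X) (max K 1) :=
      fun f hf hb => (hK f hf hb).mono (le_max_left K 1)
    refine ⟨max K 1, le_max_right _ _, fun E Z _ _ _ S hS => ?_⟩
    obtain ⟨C, hC⟩ := hS hp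
    refine ⟨fun _ => ⟨_, hU.mul_mem_summingConstants hp hK1.le E S hC⟩, ?_⟩
    rw [mul_comm, ← div_le_iff₀ hK1]
    conv_rhs => rw [summingNorm, if_neg hp]
    refine le_csInf ⟨C, hC⟩ fun C' hC' => ?_
    rw [div_le_iff₀ hK1, mul_comm]
    exact summingNorm_le hp (hU.mul_mem_summingConstants hp hK1.le E S hC')
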